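/- **Setting.** A monoid $S$ is *right amenable* if there is a finitely additive map $\mu:\mathcal P(S)\to[0,1]$ with $\mu(S)=1$ and $\mu(R_s^{-1}(E))=\mu(E)$ for all $s\in S$, $E\subseteq S$, where $R_s(x)=xs$. A *right Følner net* of $S$ is a net $(F_i)_{i\in I}$ of non-empty finite subsets of $S$ with $\lim_i |F_is\setminus F_i|/|F_i|=0$ for every $s\in S$. Let $S$ be cancellative (on both sides) and right amenable, and let $\alpha$ be a left monoid action of $S$ on an abelian group $A$ by group endomorphisms, i.e. a monoid homomorphism $\alpha:S\to\operatorname{End}(A)$. For a non-empty finite $X\subseteq A$ and a non-empty finite $F\subseteq S$ put $T_F(\alpha,X)=\sum_{s\in F}\alpha(s)(X)$ and $$H_{alg}(\alpha,X)=\lim_{i\in I}\frac{\log|T_{F_i}(\alpha,X)|}{|F_i|},$$ where $(F_i)_{i\in I}$ is a right Følner net of $S$, and let $$\mathrm{ent}(\alpha)=\sup\{H_{alg}(\alpha,X): X \text{ a finite subgroup of } A\}\in[0,\infty].$$ **Theorem (Addition Theorem).** Let $\alpha$ be a left action of a cancellative right amenable monoid $S$ on a torsion abelian group $A$ by group endomorphisms.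 Let $B$ be a subgroup of $A$ with $\alpha(s)(B)\subseteq B$ for every $s\in S$, and denote by $\alpha_B$ and $\alpha_{A/B}$ the induced actions of $S$ on $B$ and on $A/B$. Then right Følner nets of $S$ exist, the limits defining $H_{alg}$ for $\alpha$, $\alpha_B$ and $\alpha_{A/B}$ exist (as real numbers) and do not depend on the choice of the right Følner net, and $$\mathrm{ent}(\alpha)=\mathrm{ent}(\alpha_B)+\mathrm{ent}(\alpha_{A/B}).$$ -/

import Mathlib

open Filter Topology
open scoped Pointwise ENNReal

universe u v

namespace AmenableEntropy

/-- A semigroup `S` is right amenable if it carries a finitely additive probability measure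
`μ : 𝒫(S) → [0,1]` with `μ (R_s⁻¹ E) = μ E` for all `s ∈ S` and `E ⊆ S`, where `R_s x = x * s`. -/
def IsRightAmenable (S : Type u) [Mul S] : Prop :=
  ∃ μ : Set S → ℝ,
    (∀ E, μ E ∈ Set.Icc (0 : ℝ) 1) ∧
    μ Set.univ = 1 ∧
    (∀ E F : Set S, Disjoint E F → μ (E ∪ F) = μ E + μ F) ∧
    (∀ (s : S) (E : Set S), μ ((fun x => x * s) ⁻¹' E) = μ E)

open scoped Classical in
/-- A net `(F i)` of non-empty finite subsets of `S`, indexed by a directed set, is a right Følner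
net if `|F_i s \ F_i| / |F_i| → 0` for every `s ∈ S`. -/
def IsRightFolnerNet {S : Type u} [Mul S] {I : Type u} [Preorder I] (F : I → Finset S) : Prop :=
  (∀ i, (F i).Nonempty) ∧
    ∀ s : S, Tendsto
      (fun i => (((F i).image (fun x => x * s) \ F i).card : ℝ) / ((F i).card : ℝ)) atTop (𝓝 0)

section Action

variable {S : Type u} [Monoid S] {A : Type v} [AddCommGroup A]

/-- The trajectory `T_F(α, X) = ∑_{s ∈ F} α(s)(X)` (a Minkowski sum of subsets of `A`). -/
def trajectory (α : S →* AddMonoid.End A) (F : Finset S) (X : Set A) : Set A :=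
  ∑ s ∈ F, (α s) '' X

/-- `h` is the limit of `log |T_{F_i}(α, X)| / |F_i|` along every right Følner net `(F_i)` of `S`.
Index sets in the universe of `S` suffice, since the pairs (finite subset of `S`, natural number)
index a net that reaches every Følner condition. -/
def IsEntropyAt (α : S →* AddMonoid.End A) (X : Set A) (h : ℝ) : Prop :=
  ∀ (I : Type u) [Preorder I] [IsDirectedOrder I] [Nonempty I] (F : I → Finset S),
    IsRightFolnerNet F →
      Tendsto (fun i => Real.log ((trajectory α (F i) X).ncard : ℝ) / ((F i).card : ℝ))
        atTop (𝓝 h)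

/-- For every non-empty finite `X ⊆ A` the limit defining the entropy of `α` with respect to `X`
exists along every right Følner net, is the same for all of them, and is determined by this
(so that, in particular, right Følner nets exist). -/
def EntropyWellDefined (α : S →* AddMonoid.End A) : Prop :=
  ∀ X : Set A, X.Finite → X.Nonempty → ∃! h : ℝ, IsEntropyAt α X h

open scoped Classical in
/-- The algebraic entropy `H_alg(α, X)` of `α` with respect to a non-empty finite subset `X`
(with default value `0` if the limit did not exist). -/
noncomputable def entropyAt (α : S →* AddMonoid.End A) (X : Set A) : ℝ :=
  if h : ∃ r : ℝ, IsEntropyAt α X r then h.choose else 0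

/-- The algebraic entropy `ent(α) ∈ [0, ∞]`: the supremum of `H_alg(α, X)` over all finite
subgroups `X` of `A`. The numbers `H_alg(α, X)` are limits of non-negative reals. -/
noncomputable def ent (α : S →* AddMonoid.End A) : ℝ≥0∞ :=
  ⨆ (X : AddSubgroup A) (_ : (X : Set A).Finite), ENNReal.ofReal (entropyAt α (X : Set A))

/-- `B` is `α`-invariant: `α(s)(B) ⊆ B` for every `s ∈ S`. -/
def IsInvariant (α : S →* AddMonoid.End A) (B : AddSubgroup A) : Prop :=
  ∀ s : S, ∀ b ∈ B, α s b ∈ B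

/-- The action `α_B` induced by `α` on an invariant subgroup `B`. -/
def restrictAction (α : S →* AddMonoid.End A) (B : AddSubgroup A) (hB : IsInvariant α B) :
    S →* AddMonoid.End B where
  toFun s := ((α s).comp B.subtype).codRestrict B (fun b => hB s b b.2)
  map_one' := by
    ext b
    change (α 1) (b : A) = b
    rw [map_one]
    rfl
  map_mul' s t := by
    ext b
    change (α (s * t)) (b : A) = α s (α t b)
    rw [map_mul]
    rfl

/-- The action `α_{A/B}` induced by `α` on the quotient by an invariant subgroup `B`. -/
def quotientAction (α : S →* AddMonoid.End A) (B : AddSubgroup A) (hB : IsInvariant α B) :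
    S →* AddMonoid.End (A ⧸ B) where
  toFun s := QuotientAddGroup.map B B (α s) (fun b hb => hB s b hb)
  map_one' := by
    ext x
    obtain ⟨a, rfl⟩ := QuotientAddGroup.mk_surjective x
    change ((α 1 a : A) : A ⧸ B) = (a : A ⧸ B)
    rw [map_one]
    rfl
  map_mul' s t := by
    ext x
    obtain ⟨a, rfl⟩ := QuotientAddGroup.mk_surjective x
    change ((α (s * t) a : A) : A ⧸ B) = ((α s (α t a) : A) : A ⧸ B)
    rw [map_mul]
    rfl

end Action

end AmenableEntropy

/-!
The proof rests on Shearer's inequality for sumsets: if every index of `F` lies in exactly `k` of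
the sets `E j ⊆ F`, then `|∑ i ∈ F, X i| ^ k ≤ ∏ j, |∑ i ∈ E j, X i|` (`ncard_sum_pow_le_prod`). It
follows from the combinatorial Shearer inequality, applied to the set of lexicographically least
representations of the elements of the sumset, whose partial sums determine their summands.

For an almost right invariant `F`, the translates `t E ⊆ F` with `t ∈ F` cover almost all points of
`F` exactly `|E|` times, and never more often, by cancellation. Shearer's inequality then gives
`log |T_F(α, X)| / |F| ≤ log |T_E(α, X)| / |E| + o(1)` without a quasi-tiling theorem
(`log_ncard_sum_div_card_le`), so the entropy exists along every right Følner net and is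
the infimum of the averages `log |T_E(α, X)| / |E|` (`isEntropyAt_iInf`). It is unique because right
Følner nets exist: if the Følner condition failed, Hall's marriage theorem would produce a
paradoxical decomposition of `S`, contradicting the invariant mean
(`IsRightAmenable.exists_isRightFolnerNet`).

In the addition theorem, `≥` is the multiplicativity of orders in `T ∩ B → T → T / (T ∩ B)`; the
torsion hypothesis is used to dominate finite subgroups of `B` and of `A / B` by a finite subgroup
of `A`. For `≤`, given a finite subgroup `X` and a finite set `E`, put `Y = T_E(α, X) ∩ B`. Modulo
`W = T_F(α_B, Y)`, each translate `α t (T_E(α, X))` with `t ∈ F` has at most as many elements as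
`T_E(α, X) / Y`, that is, as the trajectory of the image of `X` in `A / B`. The same covering
argument in the group `A / W` yields
`log |T_F(α, X)| / |F| ≤ log |T_F(α_B, Y)| / |F| + log |T_E(α_{A/B}, X)| / |E| + o(1)`
(`log_ncard_trajectory_div_card_le_add`), and the limit along `F`, then along `E`, is the claim.
-/

namespace AmenableEntropy

/-! ### Shearer's inequality for sumsets -/

/-- Hölder's inequality for a finite product of finite families of non-negative reals, all with
the same exponent, in a form without roots. -/
theorem sum_pow_card_le_prod_sum {ι J : Type*} (s : Finset ι) (K : Finset J) (hK : K.Nonempty)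
    (c : ι → ℝ) (x : J → ι → ℝ) (hc : ∀ a ∈ s, 0 ≤ c a) (hx : ∀ j ∈ K, ∀ a ∈ s, 0 ≤ x j a)
    (h : ∀ a ∈ s, c a ^ K.card ≤ ∏ j ∈ K, x j a) :
    (∑ a ∈ s, c a) ^ K.card ≤ ∏ j ∈ K, ∑ a ∈ s, x j a := by
  have hk : K.card ≠ 0 := hK.card_ne_zero
  have hk' : (0 : ℝ) < K.card := by exact_mod_cast Nat.pos_of_ne_zero hk
  have hP : ∀ j ∈ K, 0 ≤ ∑ a ∈ s, x j a := fun j hj => Finset.sum_nonneg (hx j hj)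
  by_cases h0 : ∃ j ∈ K, ∑ a ∈ s, x j a = 0
  · obtain ⟨j, hj, hj0⟩ := h0
    have hz : ∀ a ∈ s, c a = 0 := by
      intro a ha
      have hxa : x j a = 0 := (Finset.sum_eq_zero_iff_of_nonneg (hx j hj)).1 hj0 a ha
      have := h a ha
      rw [Finset.prod_eq_zero hj hxa] at this
      exact pow_eq_zero_iff hk |>.1 (le_antisymm this (pow_nonneg (hc a ha) _))
    rw [Finset.sum_eq_zero hz, zero_pow hk]
    exact Finset.prod_nonneg hP
  · push Not at h0
    have hPpos : ∀ j ∈ K, 0 < ∑ a ∈ s, x j a := fun j hj => lt_of_le_of_ne (hP j hj) (h0 j hj).symm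
    set M := ∏ j ∈ K, ∑ a ∈ s, x j a with hM
    have hMpos : 0 < M := Finset.prod_pos hPpos
    set G := M ^ ((K.card : ℝ)⁻¹) with hG
    have hGpos : 0 < G := Real.rpow_pos_of_pos hMpos _
    have hGk : G ^ K.card = M := Real.rpow_inv_natCast_pow hMpos.le hk
    -- after normalising every `x j` to have sum one, this is the AM-GM inequality at each `a`
    have key : ∀ a ∈ s, c a / G ≤ ∑ j ∈ K, (K.card : ℝ)⁻¹ * (x j a / ∑ a ∈ s, x j a) := by
      intro a ha
      have hy : ∀ j ∈ K, 0 ≤ x j a / ∑ a ∈ s, x j a := fun j hj =>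
        div_nonneg (hx j hj a ha) (hP j hj)
      refine le_trans ?_ (Real.geom_mean_le_arith_mean_weighted K (fun _ => (K.card : ℝ)⁻¹)
        (fun j => x j a / ∑ a ∈ s, x j a) (fun _ _ => by positivity) (by
          rw [Finset.sum_const, nsmul_eq_mul]
          field_simp) hy)
      rw [Real.finsetProd_rpow K _ hy, Finset.prod_div_distrib, ← hM]
      refine le_of_pow_le_pow_left₀ hk
        (Real.rpow_nonneg (div_nonneg (Finset.prod_nonneg fun j hj => hx j hj a ha) hMpos.le) _) ?_
      rw [Real.rpow_inv_natCast_pow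
        (div_nonneg (Finset.prod_nonneg fun j hj => hx j hj a ha) hMpos.le) hk, div_pow, hGk]
      exact div_le_div_of_nonneg_right (h a ha) hMpos.le
    have hsum : (∑ a ∈ s, c a) / G ≤ 1 := by
      rw [Finset.sum_div]
      refine (Finset.sum_le_sum key).trans ?_
      rw [Finset.sum_comm]
      have : ∀ j ∈ K, ∑ a ∈ s, (K.card : ℝ)⁻¹ * (x j a / ∑ a ∈ s, x j a) = (K.card : ℝ)⁻¹ := by
        intro j hj
        rw [← Finset.mul_sum, ← Finset.sum_div, div_self (h0 j hj), mul_one]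
      rw [Finset.sum_congr rfl this, Finset.sum_const, nsmul_eq_mul]
      exact (mul_inv_cancel₀ hk'.ne').le
    rw [← hGk]
    exact pow_le_pow_left₀ (Finset.sum_nonneg hc) ((div_le_one hGpos).1 hsum) _

open scoped Classical in
/-- **Shearer's inequality**, combinatorial form. The points of `D` are determined by their
coordinates `c i`, `i ∈ F`; the map `q j` determines the coordinates in `E j`; and every coordinate
is determined by exactly `k` of the maps `q j`. Then `|D| ^ k` is at most the product of the sizes
of the images `q j (D)`. -/
theorem card_pow_le_prod_card_image {Ω ι C J β : Type*} (J₀ : Finset J) (q : J → Ω → β)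
    (E : J → Finset ι) (c : ι → Ω → C) {k : ℕ} (hk : k ≠ 0) (F : Finset ι) :
    ∀ D : Finset Ω, (∀ x ∈ D, ∀ y ∈ D, (∀ i ∈ F, c i x = c i y) → x = y) →
    (∀ j ∈ J₀, ∀ x ∈ D, ∀ y ∈ D, q j x = q j y → ∀ i ∈ F, i ∈ E j → c i x = c i y) →
    (∀ i ∈ F, (J₀.filter (fun j => i ∈ E j)).card = k) →
    D.card ^ k ≤ ∏ j ∈ J₀, (D.image (q j)).card := by
  induction F using Finset.induction_on with
  | empty =>
    intro D hinj _ _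
    rcases D.eq_empty_or_nonempty with rfl | hD
    · simp [hk]
    · have h1 : D.card ≤ 1 := Finset.card_le_one.2 fun x hx y hy => hinj x hx y hy (by simp)
      calc D.card ^ k ≤ 1 ^ k := Nat.pow_le_pow_left h1 k
        _ = 1 := one_pow k
        _ ≤ _ := Finset.one_le_prod' fun j _ => (hD.image (q j)).card_pos
  | insert n F hn ih =>
    intro D hinj hq hcov
    rcases D.eq_empty_or_nonempty with rfl | hD
    · simp [hk]
    set V := D.image (c n) with hV
    set Da : C → Finset Ω := fun a => D.filter (fun x => c n x = a) with hDa
    have hDaD : ∀ a, Da a ⊆ D := fun a => Finset.filter_subset _ _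
    -- slice `D` along the coordinate `n` and apply the induction hypothesis to the slices
    have hih : ∀ a, (Da a).card ^ k ≤ ∏ j ∈ J₀, ((Da a).image (q j)).card := by
      intro a
      refine ih (Da a) ?_ ?_ ?_
      · intro x hx y hy hxy
        refine hinj x (hDaD a hx) y (hDaD a hy) fun i hi => ?_
        rcases Finset.mem_insert.1 hi with rfl | hi
        · rw [(Finset.mem_filter.1 hx).2, (Finset.mem_filter.1 hy).2]
        · exact hxy i hi
      · intro j hj x hx y hy hxy i hi
        exact hq j hj x (hDaD a hx) y (hDaD a hy) hxy i (Finset.mem_insert_of_mem hi)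
      · intro i hi
        exact hcov i (Finset.mem_insert_of_mem hi)
    set K := J₀.filter (fun j => n ∈ E j) with hK
    have hKk : K.card = k := hcov n (Finset.mem_insert_self _ _)
    have hKne : K.Nonempty := Finset.card_pos.1 (by omega)
    set R : ℕ := ∏ j ∈ J₀.filter (fun j => ¬ n ∈ E j), (D.image (q j)).card with hR
    have hRpos : 0 < R := Finset.prod_pos fun j _ => (hD.image (q j)).card_pos
    have hslice : ∀ a, (Da a).card ^ k ≤ (∏ j ∈ K, ((Da a).image (q j)).card) * R := by
      intro a
      refine (hih a).trans ?_
      rw [← Finset.prod_filter_mul_prod_filter_not J₀ (fun j => n ∈ E j)]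
      refine Nat.mul_le_mul_left _ (Finset.prod_le_prod' fun j _ => ?_)
      exact Finset.card_le_card (Finset.image_subset_image (hDaD a))
    have hcard : D.card = ∑ a ∈ V, (Da a).card := Finset.card_eq_sum_card_image _ _
    have hKsum : ∀ j ∈ K, ∑ a ∈ V, ((Da a).image (q j)).card ≤ (D.image (q j)).card := by
      intro j hj
      rw [← Finset.card_biUnion]
      · refine Finset.card_le_card (Finset.biUnion_subset.2 fun a _ => ?_)
        exact Finset.image_subset_image (hDaD a)
      · intro a _ b _ hab
        refine Finset.disjoint_left.2 fun z hz hz' => hab ?_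
        obtain ⟨x, hx, rfl⟩ := Finset.mem_image.1 hz
        obtain ⟨y, hy, hxy⟩ := Finset.mem_image.1 hz'
        rw [← (Finset.mem_filter.1 hx).2, ← (Finset.mem_filter.1 hy).2]
        exact (hq j (Finset.mem_filter.1 hj).1 y (hDaD b hy) x (hDaD a hx) hxy n
          (Finset.mem_insert_self _ _) (Finset.mem_filter.1 hj).2).symm
    have hR0 : (0 : ℝ) < R := Nat.cast_pos.2 hRpos
    obtain ⟨r, hrpos, hrk⟩ : ∃ r : ℝ, 0 < r ∧ r ^ k = R :=
      ⟨(R : ℝ) ^ ((k : ℝ)⁻¹), Real.rpow_pos_of_pos hR0 _, Real.rpow_inv_natCast_pow hR0.le hk⟩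
    have hslice' : ∀ a ∈ V, (((Da a).card : ℝ) / r) ^ K.card ≤
        ∏ j ∈ K, (((Da a).image (q j)).card : ℝ) := by
      intro a _
      rw [hKk, div_pow, hrk, div_le_iff₀ hR0]
      exact_mod_cast hslice a
    have hH := sum_pow_card_le_prod_sum V K hKne (fun a => ((Da a).card : ℝ) / r)
      (fun j a => (((Da a).image (q j)).card : ℝ))
      (fun a _ => div_nonneg (Nat.cast_nonneg _) hrpos.le)
      (fun j _ a _ => Nat.cast_nonneg _) hslice'
    rw [← Finset.sum_div, hKk, div_pow, hrk, div_le_iff₀ hR0] at hH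
    have hH' : (∑ a ∈ V, (Da a).card) ^ k
        ≤ (∏ j ∈ K, ∑ a ∈ V, ((Da a).image (q j)).card) * R := by exact_mod_cast hH
    rw [hcard]
    refine hH'.trans ?_
    rw [← Finset.prod_filter_mul_prod_filter_not J₀ (fun j => n ∈ E j)]
    exact Nat.mul_le_mul_right _ (Finset.prod_le_prod' hKsum)

theorem finite_finsetSum {ι G : Type*} [AddCommMonoid G] {X : ι → Set G}
    (hX : ∀ i, (X i).Finite) (F : Finset ι) : (∑ i ∈ F, X i).Finite := by
  classical
  induction F using Finset.induction_on with
  | empty => simp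
  | insert a F ha ih => rw [Finset.sum_insert ha]; exact (hX a).add ih

/-- Every element `z` of a sumset `∑ i ∈ F, X i` has a canonical representation
`z = ∑ i ∈ F, c i z` such that a partial sum of the representation determines its summands: take
the lexicographically least representation for a well-order of the group. -/
theorem exists_canonical_representation {G ι : Type*} [AddCommGroup G] (X : ι → Set G)
    (F : Finset ι) :
    ∃ c : ι → G → G, (∀ z ∈ ∑ i ∈ F, X i, (∀ i ∈ F, c i z ∈ X i) ∧ ∑ i ∈ F, c i z = z) ∧
      ∀ I ⊆ F, ∀ z ∈ ∑ i ∈ F, X i, ∀ z' ∈ ∑ i ∈ F, X i,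
        ∑ i ∈ I, c i z = ∑ i ∈ I, c i z' → ∀ i ∈ I, c i z = c i z' := by
  classical
  induction F using Finset.induction_on with
  | empty =>
    refine ⟨fun _ z => z, by simp, ?_⟩
    intro I hI z _ z' _ _ i hi
    exact absurd (hI hi) (Finset.notMem_empty i)
  | insert n F hn ih =>
    obtain ⟨c, hc1, hc2⟩ := ih
    let Q : G → Set G := fun z => {a | a ∈ X n ∧ z - a ∈ ∑ i ∈ F, X i}
    have hQ : ∀ z ∈ ∑ i ∈ insert n F, X i, (Q z).Nonempty := by
      intro z hz
      rw [Finset.sum_insert hn] at hz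
      obtain ⟨a, ha, y, hy, rfl⟩ := Set.mem_add.1 hz
      exact ⟨a, ha, by simpa using hy⟩
    have wf : WellFounded (WellOrderingRel (α := G)) := WellOrderingRel.isWellOrder.wf
    let m : G → G := fun z => if h : (Q z).Nonempty then wf.min (Q z) h else 0
    have hm : ∀ z ∈ ∑ i ∈ insert n F, X i, m z ∈ Q z := by
      intro z hz
      simp only [m, dif_pos (hQ z hz)]
      exact wf.min_mem _ _
    have hmin : ∀ z ∈ ∑ i ∈ insert n F, X i, ∀ a ∈ Q z, ¬ WellOrderingRel a (m z) := by
      intro z hz a ha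
      simp only [m, dif_pos (hQ z hz)]
      exact wf.not_lt_min _ ha
    have hne : ∀ i ∈ F, i ≠ n := fun i hi h => hn (h ▸ hi)
    refine ⟨fun i z => if i = n then m z else c i (z - m z), ?_, ?_⟩
    · intro z hz
      obtain ⟨h1, h2⟩ := hc1 _ (hm z hz).2
      refine ⟨fun i hi => ?_, ?_⟩
      · rcases Finset.mem_insert.1 hi with rfl | hi
        · simpa using (hm z hz).1
        · simpa [hne i hi] using h1 i hi
      · dsimp only
        rw [Finset.sum_insert hn, if_pos rfl,
          Finset.sum_congr rfl (fun i hi => if_neg (hne i hi)), h2]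
        abel
    · intro I hI z hz z' hz' hsum
      dsimp only at hsum
      have hIF : I.erase n ⊆ F := fun i hi =>
        (Finset.mem_insert.1 (hI (Finset.mem_of_mem_erase hi))).resolve_left
          (Finset.ne_of_mem_erase hi)
      have hsub : ∀ w, ∑ i ∈ I.erase n, (if i = n then m w else c i (w - m w)) =
          ∑ i ∈ I.erase n, c i (w - m w) := fun w =>
        Finset.sum_congr rfl fun i hi => if_neg (Finset.ne_of_mem_erase hi)
      by_cases hnI : n ∈ I
      · rw [← Finset.add_sum_erase _ _ hnI, ← Finset.add_sum_erase _ _ hnI, hsub, hsub,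
          if_pos rfl, if_pos rfl] at hsum
        -- the summands of one of the two partial sums could be exchanged for those of the other
        have key : ∀ w ∈ ∑ i ∈ insert n F, X i, ∀ w' ∈ ∑ i ∈ insert n F, X i,
            m w + ∑ i ∈ I.erase n, c i (w - m w) = m w' + ∑ i ∈ I.erase n, c i (w' - m w') →
            ¬ WellOrderingRel (m w) (m w') := by
          intro w hw w' hw' hww'
          refine hmin w' hw' (m w) ⟨(hm w hw).1, ?_⟩
          obtain ⟨h1, -⟩ := hc1 _ (hm w hw).2
          obtain ⟨h1', h2'⟩ := hc1 _ (hm w' hw').2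
          rw [Set.mem_finsetSum]
          refine ⟨fun i => if i ∈ I.erase n then c i (w - m w) else c i (w' - m w'), ?_, ?_⟩
          · intro i hi
            dsimp only
            split_ifs
            exacts [h1 i hi, h1' i hi]
          · rw [← Finset.sum_sdiff hIF,
              Finset.sum_congr rfl (fun i hi => if_neg (Finset.mem_sdiff.1 hi).2),
              Finset.sum_congr rfl (fun i hi => if_pos hi)]
            rw [← Finset.sum_sdiff hIF] at h2'
            have h3 : w' = m w' + (∑ i ∈ F \ I.erase n, c i (w' - m w') +
                ∑ i ∈ I.erase n, c i (w' - m w')) := by rw [h2']; abel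
            have h4 : ∑ i ∈ I.erase n, c i (w - m w) =
              m w' + ∑ i ∈ I.erase n, c i (w' - m w') - m w := by rw [← hww']; abel
            rw [h4]
            conv_rhs => rw [h3]
            abel
        have hmm : m z = m z' := by
          rcases trichotomous_of WellOrderingRel (m z) (m z') with h | h | h
          · exact absurd h (key z hz z' hz' hsum)
          · exact h
          · exact absurd h (key z' hz' z hz hsum.symm)
        have hrest := hc2 _ hIF _ (hm z hz).2 _ (hm z' hz').2
          (add_left_cancel (hmm ▸ hsum : m z' + _ = m z' + _))
        intro i hi
        by_cases hin : i = n
        · simp [hin, hmm]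
        · simpa [hin] using hrest i (Finset.mem_erase.2 ⟨hin, hi⟩)
      · rw [← Finset.erase_eq_of_notMem hnI, hsub, hsub] at hsum
        have hrest := hc2 _ hIF _ (hm z hz).2 _ (hm z' hz').2 hsum
        intro i hi
        have hin : i ≠ n := fun h => hnI (h ▸ hi)
        simpa [hin] using hrest i (Finset.mem_erase.2 ⟨hin, hi⟩)

open scoped Classical in
/-- **Shearer's inequality for sumsets**: if every index in `F` lies in exactly `k` of the sets
`E j ⊆ F`, then `|∑ i ∈ F, X i| ^ k ≤ ∏ j, |∑ i ∈ E j, X i|`. -/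
theorem ncard_sum_pow_le_prod {G ι J : Type*} [AddCommGroup G] (X : ι → Set G)
    (hX : ∀ i, (X i).Finite) (F : Finset ι) (J₀ : Finset J) (E : J → Finset ι)
    (hE : ∀ j ∈ J₀, E j ⊆ F) {k : ℕ} (hk : k ≠ 0)
    (hcov : ∀ i ∈ F, (J₀.filter (fun j => i ∈ E j)).card = k) :
    (∑ i ∈ F, X i).ncard ^ k ≤ ∏ j ∈ J₀, (∑ i ∈ E j, X i).ncard := by
  have hfin := finite_finsetSum hX
  obtain ⟨c, hc1, hc2⟩ := exists_canonical_representation X F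
  have hD : ∀ x, x ∈ (hfin F).toFinset ↔ x ∈ ∑ i ∈ F, X i := fun x => (hfin F).mem_toFinset
  have := card_pow_le_prod_card_image J₀ (fun j z => ∑ i ∈ E j, c i z) E c hk F (hfin F).toFinset
    (fun x hx y hy hxy => by
      rw [← (hc1 x ((hD x).1 hx)).2, ← (hc1 y ((hD y).1 hy)).2]
      exact Finset.sum_congr rfl hxy)
    (fun j hj x hx y hy hxy i _ hi =>
      hc2 (E j) (hE j hj) x ((hD x).1 hx) y ((hD y).1 hy) hxy i hi) hcov
  rw [Set.ncard_eq_toFinset_card _ (hfin F)]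
  refine this.trans (Finset.prod_le_prod' fun j hj => ?_)
  rw [← Set.ncard_coe_finset]
  refine Set.ncard_le_ncard ?_ (hfin _)
  intro z hz
  obtain ⟨x, hx, rfl⟩ := Finset.mem_image.1 (Finset.mem_coe.1 hz)
  exact Set.finsetSum_mem_finsetSum _ _ _ fun i hi => (hc1 x ((hD x).1 hx)).1 i (hE j hj hi)

/-! ### Amenability and Følner nets -/

/-- Finite additivity of a set function over a finite family of pairwise disjoint sets. -/
theorem measure_biUnion_eq_sum {S P : Type*} {μ : Set S → ℝ}
    (hadd : ∀ E F : Set S, Disjoint E F → μ (E ∪ F) = μ E + μ F) (Q : Finset P) (C : P → Set S)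
    (hC : ∀ p ∈ Q, ∀ q ∈ Q, p ≠ q → Disjoint (C p) (C q)) :
    μ (⋃ p ∈ Q, C p) = ∑ p ∈ Q, μ (C p) := by
  classical
  have hempty : μ ∅ = 0 := by
    have := hadd ∅ ∅ (Set.disjoint_empty _)
    rw [Set.union_empty] at this
    linarith
  induction Q using Finset.induction_on with
  | empty => simpa using hempty
  | insert a Q ha ih =>
    rw [Finset.set_biUnion_insert, Finset.sum_insert ha, hadd, ih]
    · exact fun p hp q hq => hC p (Finset.mem_insert_of_mem hp) q (Finset.mem_insert_of_mem hq)
    · refine Set.disjoint_iUnion₂_right.2 fun q hq => ?_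
      exact hC a (Finset.mem_insert_self _ _) q (Finset.mem_insert_of_mem hq)
        fun h => ha (h ▸ hq)

open scoped Classical in
/-- A right amenable, right cancellative monoid has no paradoxical decomposition: no finite set `T`
doubles the size of every finite set by right multiplication. Otherwise Hall's marriage theorem
would give two injections `x ↦ φ (x, i) ∈ x T` of `S` into itself with disjoint images; cut into
finitely many right translates, each of these images would have mean one. -/
theorem IsRightAmenable.exists_card_mul_lt {S : Type u} [Monoid S] [IsRightCancelMul S]
    (hS : IsRightAmenable S) (T : Finset S) : ∃ F : Finset S, (F * T).card < 2 * F.card := by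
  by_contra! hT
  obtain ⟨μ, h01, huniv, hadd, hinv⟩ := hS
  have hall : ∀ s : Finset (S × Bool),
      s.card ≤ (s.biUnion fun p => T.image (fun t => p.1 * t)).card := by
    intro s
    have h1 : s.card ≤ 2 * (s.image Prod.fst).card := by
      have : s ⊆ (s.image Prod.fst) ×ˢ (Finset.univ : Finset Bool) := fun p hp =>
        Finset.mem_product.2 ⟨Finset.mem_image_of_mem _ hp, Finset.mem_univ _⟩
      refine (Finset.card_le_card this).trans ?_
      rw [Finset.card_product, Finset.card_univ, Fintype.card_bool, mul_comm]
    refine (h1.trans (hT _)).trans (Finset.card_le_card fun z hz => ?_)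
    obtain ⟨x, hx, t, ht, rfl⟩ := Finset.mem_mul.1 hz
    obtain ⟨p, hp, rfl⟩ := Finset.mem_image.1 hx
    exact Finset.mem_biUnion.2 ⟨p, hp, Finset.mem_image_of_mem _ ht⟩
  obtain ⟨φ, hφ, hφT⟩ := (Finset.all_card_le_biUnion_card_iff_exists_injective _).1 hall
  have hτ : ∀ p : S × Bool, ∃ t ∈ T, p.1 * t = φ p := fun p => Finset.mem_image.1 (hφT p)
  choose τ hτT hτφ using hτ
  let A : Bool × S → Set S := fun q => {x | τ (x, q.1) = q.2}
  let C : Bool × S → Set S := fun q => (fun x => x * q.2) '' A q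
  have hCA : ∀ q, μ (C q) = μ (A q) := fun q => by
    rw [← hinv q.2 (C q), Set.preimage_image_eq _ (mul_left_injective q.2)]
  have hA : ∀ i : Bool, ∑ t ∈ T, μ (A (i, t)) = 1 := by
    intro i
    rw [← measure_biUnion_eq_sum hadd T (fun t => A (i, t)), ← huniv]
    · congr 1
      refine Set.eq_univ_of_forall fun x => Set.mem_iUnion₂.2 ⟨τ (x, i), hτT _, rfl⟩
    · intro t _ t' _ htt'
      exact Set.disjoint_left.2 fun x hx hx' => htt' (hx.symm.trans hx')
  have hC : μ (⋃ q ∈ (Finset.univ : Finset Bool) ×ˢ T, C q) =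
      ∑ q ∈ (Finset.univ : Finset Bool) ×ˢ T, μ (C q) := by
    refine measure_biUnion_eq_sum hadd _ _ ?_
    rintro ⟨i, t⟩ _ ⟨i', t'⟩ _ hne
    refine Set.disjoint_left.2 ?_
    rintro z ⟨x, hx, rfl⟩ ⟨y, hy, hyx⟩
    have hx' : τ (x, i) = t := hx
    have hy' : τ (y, i') = t' := hy
    have h1 : φ (y, i') = φ (x, i) := by
      rw [← hτφ, ← hτφ, hx', hy']
      exact hyx
    have h2 := hφ h1
    obtain ⟨rfl, rfl⟩ := Prod.mk.inj h2
    exact hne (by rw [← hx', ← hy'])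
  have hle := (h01 (⋃ q ∈ (Finset.univ : Finset Bool) ×ˢ T, C q)).2
  rw [hC, Finset.sum_product, Finset.sum_congr rfl fun i _ =>
    (Finset.sum_congr rfl fun t _ => hCA (i, t)).trans (hA i)] at hle
  norm_num at hle

open scoped Classical in
/-- The Følner condition. If it failed, right multiplication by a large power of `K ∪ {1}` would
double the size of every finite set. -/
theorem IsRightAmenable.exists_almost_invariant {S : Type u} [Monoid S] [IsRightCancelMul S]
    (hS : IsRightAmenable S) (K : Finset S) {ε : ℝ} (hε : 0 < ε) :
    ∃ F : Finset S, F.Nonempty ∧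
      ∀ s ∈ K, (((F.image fun x => x * s) \ F).card : ℝ) ≤ ε * F.card := by
  by_contra! hK
  set K' := insert 1 K
  have hstep : ∀ F : Finset S, (1 + ε) * F.card ≤ ((F * K').card : ℝ) := by
    intro F
    rcases F.eq_empty_or_nonempty with rfl | hF
    · simp
    obtain ⟨s, hs, hlt⟩ := hK F hF
    have hsub : F ∪ ((F.image fun x => x * s) \ F) ⊆ F * K' := by
      refine Finset.union_subset (fun x hx => ?_) (Finset.sdiff_subset.trans fun x hx => ?_)
      · simpa using Finset.mul_mem_mul hx (Finset.mem_insert_self 1 K)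
      · obtain ⟨y, hy, rfl⟩ := Finset.mem_image.1 hx
        exact Finset.mul_mem_mul hy (Finset.mem_insert_of_mem hs)
    have hcard := Finset.card_le_card hsub
    rw [Finset.card_union_of_disjoint Finset.disjoint_sdiff] at hcard
    have : (F.card : ℝ) + (((F.image fun x => x * s) \ F).card : ℝ) ≤ ((F * K').card : ℝ) := by
      exact_mod_cast hcard
    linarith
  have hpow : ∀ (n : ℕ) (F : Finset S), (1 + ε) ^ n * F.card ≤ ((F * K' ^ n).card : ℝ) := by
    intro n
    induction n with
    | zero => intro F; simp
    | succ n ih =>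
      intro F
      have h1 := ih F
      have h2 := hstep (F * K' ^ n)
      rw [pow_succ K', ← mul_assoc, pow_succ']
      nlinarith
  obtain ⟨n, hn⟩ := pow_unbounded_of_one_lt 2 (by linarith : 1 < 1 + ε)
  obtain ⟨F, hF⟩ := hS.exists_card_mul_lt (K' ^ n)
  have h1 := hpow n F
  have h2 : ((F * K' ^ n).card : ℝ) < 2 * F.card := by exact_mod_cast hF
  have h3 : 2 * (F.card : ℝ) ≤ (1 + ε) ^ n * F.card :=
    mul_le_mul_of_nonneg_right hn.le (Nat.cast_nonneg _)
  linarith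

/-- Right Følner nets exist; the pairs (finite subset of `S`, natural number) serve as indices. -/
theorem IsRightAmenable.exists_isRightFolnerNet {S : Type u} [Monoid S] [IsRightCancelMul S]
    (hS : IsRightAmenable S) : ∃ F : Finset S × ℕ → Finset S, IsRightFolnerNet F := by
  classical
  have h : ∀ p : Finset S × ℕ, ∃ F : Finset S, F.Nonempty ∧ ∀ s ∈ p.1,
      (((F.image fun x => x * s) \ F).card : ℝ) ≤ 1 / ((p.2 : ℝ) + 1) * F.card := fun p => by
    convert! hS.exists_almost_invariant p.1 (Nat.one_div_pos_of_nat (α := ℝ) (n := p.2))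
  choose F hF hFs using h
  refine ⟨F, hF, fun s => ?_⟩
  have hlim : Tendsto (fun p : Finset S × ℕ => 1 / ((p.2 : ℝ) + 1)) atTop (𝓝 0) := by
    rw [← prod_atTop_atTop_eq]
    exact tendsto_one_div_add_atTop_nhds_zero_nat.comp tendsto_snd
  refine squeeze_zero' (Eventually.of_forall fun p => by positivity) ?_ hlim
  filter_upwards [eventually_ge_atTop (({s} : Finset S), 0)] with p hp
  rw [div_le_iff₀ (by exact_mod_cast (hF p).card_pos)]
  convert! hFs p s (hp.1 (Finset.mem_singleton_self s))

/-! ### Covers by translates and convergence along Følner nets -/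

open scoped Classical in
/-- The total relative defect `∑ e ∈ E, |F e \ F| / |F|` of `F` being invariant under right
multiplication by the elements of `E`. -/
noncomputable def folnerDefect {S : Type*} [Mul S] (E F : Finset S) : ℝ :=
  ∑ e ∈ E, (((F.image fun x => x * e) \ F).card : ℝ) / (F.card : ℝ)

theorem IsRightFolnerNet.tendsto_folnerDefect {S I : Type u} [Mul S] [Preorder I]
    {F : I → Finset S} (hF : IsRightFolnerNet F) (E : Finset S) :
    Tendsto (fun i => folnerDefect E (F i)) atTop (𝓝 0) := by
  simpa [folnerDefect] using tendsto_finsetSum E fun e _ => hF.2 e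

theorem nonempty_finsetSum {ι G : Type*} [AddCommMonoid G] {X : ι → Set G}
    (hX : ∀ i, (X i).Nonempty) (F : Finset ι) : (∑ i ∈ F, X i).Nonempty := by
  classical
  induction F using Finset.induction_on with
  | empty => simp
  | insert a F ha ih => rw [Finset.sum_insert ha]; exact (hX a).add ih

open scoped Classical in
/-- The translates `t E ⊆ F` with `t ∈ F` cover every point of `F` at most `|E|` times, and the
total deficit is controlled by the Følner defect. Filling up with singletons gives an exact
`|E|`-fold cover of `F`, to which Shearer's inequality for sumsets applies. -/
theorem log_ncard_sum_div_card_le {S G : Type*} [Monoid S] [IsCancelMul S] [AddCommGroup G]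
    {X : S → Set G} (hX : ∀ s, (X s).Finite) (hX' : ∀ s, (X s).Nonempty) {E F : Finset S}
    (hE : E.Nonempty) (hF : F.Nonempty) {a b : ℝ} (ha0 : 0 ≤ a) (hb0 : 0 ≤ b)
    (ha : ∀ t ∈ F, (∀ e ∈ E, t * e ∈ F) →
      Real.log ((∑ s ∈ E.image (fun e => t * e), X s).ncard : ℝ) ≤ a)
    (hb : ∀ s ∈ F, Real.log ((X s).ncard : ℝ) ≤ b) :
    Real.log ((∑ s ∈ F, X s).ncard : ℝ) / F.card ≤ a / E.card + b * folnerDefect E F := by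
  set k := E.card with hkdef
  have hk : k ≠ 0 := hE.card_ne_zero
  set F' := F.filter (fun t => ∀ e ∈ E, t * e ∈ F) with hF'
  set tr : S → Finset S := fun t => E.image (fun e => t * e) with htr
  have htrF : ∀ t ∈ F', tr t ⊆ F := by
    intro t ht x hx
    obtain ⟨e, he, rfl⟩ := Finset.mem_image.1 hx
    exact (Finset.mem_filter.1 ht).2 e he
  set mult : S → ℕ := fun x => (F'.filter (fun t => x ∈ tr t)).card with hmult
  have hmult_le : ∀ x, mult x ≤ k := by
    intro x
    refine Finset.card_le_card_of_forall_subsingleton (fun t e => t * e = x) ?_ ?_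
    · intro t ht
      obtain ⟨e, he, hex⟩ := Finset.mem_image.1 (Finset.mem_filter.1 ht).2
      exact ⟨e, he, hex⟩
    · intro e _ t ht t' ht'
      exact mul_right_cancel (ht.2.trans ht'.2.symm)
  set P := (F ×ˢ Finset.range k).filter (fun p => mult p.1 ≤ p.2) with hP
  let Ej : S ⊕ (S × ℕ) → Finset S := Sum.elim tr fun p => {p.1}
  have hcov : ∀ i ∈ F, ((F'.disjSum P).filter (fun j => i ∈ Ej j)).card = k := by
    intro i hi
    have h1 : (F'.disjSum P).filter (fun j => i ∈ Ej j) =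
        (F'.filter fun t => i ∈ tr t).disjSum (P.filter fun p => i = p.1) := by
      ext j
      rcases j with t | p <;> simp [Ej]
    have h2 : (P.filter fun p => i = p.1) = (Finset.Ico (mult i) k).image (fun c => (i, c)) := by
      ext ⟨x, c⟩
      simp only [hP, Finset.mem_filter, Finset.mem_product, Finset.mem_range, Finset.mem_image,
        Finset.mem_Ico, Prod.mk.injEq]
      constructor
      · rintro ⟨⟨⟨_, h⟩, h'⟩, rfl⟩
        exact ⟨c, ⟨h', h⟩, rfl, rfl⟩
      · rintro ⟨c', ⟨h, h'⟩, rfl, rfl⟩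
        exact ⟨⟨⟨hi, h'⟩, h⟩, rfl⟩
    rw [h1, Finset.card_disjSum, h2, Finset.card_image_of_injective _ (Prod.mk_right_injective i),
      Nat.card_Ico]
    exact Nat.add_sub_of_le (hmult_le i)
  have hsh := ncard_sum_pow_le_prod X hX F (F'.disjSum P) Ej (by
    rintro (t | p) hj
    · exact htrF t (Finset.inl_mem_disjSum.1 hj)
    · have hp := Finset.inr_mem_disjSum.1 hj
      exact Finset.singleton_subset_iff.2 (Finset.mem_product.1 (Finset.mem_filter.1 hp).1).1)
    hk hcov
  have hpos : ∀ H : Finset S, (0 : ℝ) < ((∑ s ∈ H, X s).ncard : ℝ) := fun H => by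
    exact_mod_cast (Set.ncard_pos (finite_finsetSum hX H)).2 (nonempty_finsetSum hX' H)
  have hlog : (k : ℝ) * Real.log ((∑ s ∈ F, X s).ncard : ℝ) ≤ F'.card * a + P.card * b := by
    have h1 : ((∑ s ∈ F, X s).ncard : ℝ) ^ k ≤
        ∏ j ∈ F'.disjSum P, ((∑ s ∈ Ej j, X s).ncard : ℝ) := by exact_mod_cast hsh
    have h2 := Real.log_le_log (pow_pos (hpos F) k) h1
    rw [Real.log_pow, Real.log_prod (fun j _ => (hpos _).ne'), Finset.sum_disjSum] at h2
    refine h2.trans (add_le_add ?_ ?_)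
    · rw [← nsmul_eq_mul]
      refine Finset.sum_le_card_nsmul _ _ _ fun t ht => ?_
      exact ha t (Finset.mem_filter.1 ht).1 (Finset.mem_filter.1 ht).2
    · rw [← nsmul_eq_mul]
      refine Finset.sum_le_card_nsmul _ _ _ fun p hp => ?_
      simpa [Ej] using hb p.1 (Finset.mem_product.1 (Finset.mem_filter.1 hp).1).1
  -- double counting of the pairs `(t, x)` with `x ∈ t E`, where `|t E| = |E|`
  have hPcard : P.card + F'.card * k = F.card * k := by
    have h1 : ((F ×ˢ Finset.range k).filter (fun p => ¬ mult p.1 ≤ p.2)).card =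
        ∑ x ∈ F, mult x := by
      have : ((F ×ˢ Finset.range k).filter (fun p => ¬ mult p.1 ≤ p.2)) =
          (F.sigma fun x => Finset.range (mult x)).image (fun p => (p.1, p.2)) := by
        ext ⟨x, c⟩
        simp only [Finset.mem_filter, Finset.mem_product, Finset.mem_range, Finset.mem_image,
          Finset.mem_sigma, Prod.mk.injEq, Sigma.exists, not_le]
        constructor
        · rintro ⟨⟨h, _⟩, h'⟩
          exact ⟨x, c, ⟨h, h'⟩, rfl, rfl⟩
        · rintro ⟨x', c', ⟨h, h'⟩, rfl, rfl⟩
          exact ⟨⟨h, h'.trans_le (hmult_le _)⟩, h'⟩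
      rw [this, Finset.card_image_of_injective, Finset.card_sigma]
      · simp
      · rintro ⟨x, c⟩ ⟨x', c'⟩ h
        obtain ⟨rfl, rfl⟩ := Prod.mk.inj h
        rfl
    have h2 : ∑ x ∈ F, mult x = F'.card * k := by
      have h3 := Finset.sum_card_bipartiteAbove_eq_sum_card_bipartiteBelow (s := F') (t := F)
        (fun t x => x ∈ tr t)
      have h4 : ∀ t ∈ F', (F.bipartiteAbove (fun t x => x ∈ tr t) t).card = k := by
        intro t ht
        have : F.bipartiteAbove (fun t x => x ∈ tr t) t = tr t := by
          ext x
          simp only [Finset.mem_bipartiteAbove]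
          exact ⟨fun h => h.2, fun h => ⟨htrF t ht h, h⟩⟩
        rw [this]
        exact Finset.card_image_of_injective _ (mul_right_injective t)
      rw [Finset.sum_congr rfl h4, Finset.sum_const, smul_eq_mul] at h3
      exact h3.symm
    rw [← h2, ← h1, hP, Finset.card_filter_add_card_filter_not, Finset.card_product,
      Finset.card_range]
  have hdef : (F.card : ℝ) - F'.card ≤ ∑ e ∈ E, (((F.image fun x => x * e) \ F).card : ℝ) := by
    have h1 : F ⊆ F' ∪ E.biUnion (fun e => F.filter (fun t => t * e ∉ F)) := by
      intro t ht
      by_cases h : ∀ e ∈ E, t * e ∈ F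
      · exact Finset.mem_union_left _ (Finset.mem_filter.2 ⟨ht, h⟩)
      · push Not at h
        obtain ⟨e, he, hte⟩ := h
        exact Finset.mem_union_right _ (Finset.mem_biUnion.2 ⟨e, he, Finset.mem_filter.2 ⟨ht, hte⟩⟩)
    have h2 : ∀ e ∈ E, (F.filter (fun t => t * e ∉ F)).card ≤
        ((F.image fun x => x * e) \ F).card := by
      intro e _
      refine Finset.card_le_card_of_injOn (fun x => x * e) ?_ (mul_left_injective e).injOn
      intro t ht
      obtain ⟨ht1, ht2⟩ := Finset.mem_filter.1 (Finset.mem_coe.1 ht)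
      exact Finset.mem_coe.2 (Finset.mem_sdiff.2 ⟨Finset.mem_image_of_mem _ ht1, ht2⟩)
    have h3 : F.card ≤ F'.card + ∑ e ∈ E, ((F.image fun x => x * e) \ F).card :=
      (Finset.card_le_card h1).trans ((Finset.card_union_le _ _).trans
        (Nat.add_le_add_left (Finset.card_biUnion_le.trans (Finset.sum_le_sum h2)) _))
    have h4 : (F.card : ℝ) ≤ F'.card + ∑ e ∈ E, (((F.image fun x => x * e) \ F).card : ℝ) := by
      exact_mod_cast h3
    linarith
  have hk0 : (0 : ℝ) < k := by exact_mod_cast Nat.pos_of_ne_zero hk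
  have hF0 : (0 : ℝ) < F.card := by exact_mod_cast hF.card_pos
  have hF'F : (F'.card : ℝ) ≤ F.card := by
    exact_mod_cast Finset.card_le_card (Finset.filter_subset _ F)
  have hPc : (P.card : ℝ) = ((F.card : ℝ) - F'.card) * k := by
    have : (P.card : ℝ) + F'.card * k = F.card * k := by exact_mod_cast hPcard
    linarith
  set d := ∑ e ∈ E, (((F.image fun x => x * e) \ F).card : ℝ) with hd
  have hfd : folnerDefect E F = d / F.card := by rw [folnerDefect, ← Finset.sum_div]
  rw [hfd, div_le_iff₀ hF0, ← mul_le_mul_iff_right₀ hk0]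
  calc (k : ℝ) * Real.log ((∑ s ∈ F, X s).ncard : ℝ)
      ≤ F'.card * a + ((F.card : ℝ) - F'.card) * k * b := by rw [← hPc]; exact hlog
    _ ≤ F.card * a + d * k * b := by gcongr
    _ = k * ((a / k + b * (d / F.card)) * F.card) := by field_simp

/-- If the average of `f` on `H` exceeds its average on any other set `E` by at most a multiple of
the Følner defect of `H` relative to `E`, then the averages of `f` converge along every right Følner
net, to their infimum. -/
theorem IsRightFolnerNet.tendsto_div_card {S I : Type u} [Mul S] [Preorder I]
    {F : I → Finset S} (hF : IsRightFolnerNet F) {f : Finset S → ℝ} {b : ℝ} (hf : ∀ H, 0 ≤ f H)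
    (h : ∀ E H : Finset S, E.Nonempty → H.Nonempty →
      f H / H.card ≤ f E / E.card + b * folnerDefect E H) :
    Tendsto (fun i => f (F i) / (F i).card) atTop
      (𝓝 (⨅ E : {E : Finset S // E.Nonempty}, f E / (E : Finset S).card)) := by
  have hbdd : BddBelow (Set.range fun E : {E : Finset S // E.Nonempty} =>
      f E / (E : Finset S).card) :=
    ⟨0, by rintro _ ⟨E, rfl⟩; exact div_nonneg (hf _) (Nat.cast_nonneg _)⟩
  refine tendsto_order.2 ⟨fun r hr => ?_, fun r hr => ?_⟩
  · exact Eventually.of_forall fun i => hr.trans_le (ciInf_le hbdd ⟨F i, hF.1 i⟩)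
  · rcases isEmpty_or_nonempty I with hI | ⟨⟨i₀⟩⟩
    · exact Eventually.of_forall fun i => isEmptyElim i
    have : Nonempty {E : Finset S // E.Nonempty} := ⟨⟨F i₀, hF.1 i₀⟩⟩
    obtain ⟨⟨E, hE⟩, hEr⟩ := exists_lt_of_ciInf_lt hr
    have hlim : Tendsto (fun i => f E / E.card + b * folnerDefect E (F i)) atTop
        (𝓝 (f E / E.card + b * 0)) :=
      ((hF.tendsto_folnerDefect E).const_mul b).const_add _
    rw [mul_zero, add_zero] at hlim
    filter_upwards [hlim.eventually_lt_const hEr] with i hi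
    exact (h E (F i) hE (hF.1 i)).trans_lt hi

/-! ### Trajectories and existence of the entropy -/

section Trajectory

variable {S : Type u} [Monoid S] {A : Type v} [AddCommGroup A] {α : S →* AddMonoid.End A}

theorem image_trajectory {A' : Type*} [AddCommGroup A'] {α' : S →* AddMonoid.End A'}
    (φ : A →+ A') (h : ∀ s a, φ (α s a) = α' s (φ a)) (F : Finset S) (X : Set A) :
    φ '' trajectory α F X = trajectory α' F (φ '' X) := by
  rw [trajectory, trajectory, Set.image_finsetSum]
  refine Finset.sum_congr rfl fun s _ => ?_
  rw [Set.image_image, Set.image_image]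
  exact Set.image_congr fun a _ => h s a

open scoped Classical in
theorem trajectory_image_mul [IsLeftCancelMul S] (t : S) (E : Finset S) (X : Set A) :
    trajectory α (E.image fun e => t * e) X = α t '' trajectory α E X := by
  rw [trajectory, trajectory, Finset.sum_image (mul_right_injective t).injOn,
    Set.image_finsetSum]
  refine Finset.sum_congr rfl fun s _ => ?_
  rw [Set.image_image, map_mul]
  rfl

theorem trajectory_mono (F : Finset S) {X Y : Set A} (h : X ⊆ Y) :
    trajectory α F X ⊆ trajectory α F Y :=
  Set.finsetSum_subset_finsetSum _ _ _ fun _ _ => Set.image_mono h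

theorem trajectory_finite (F : Finset S) {X : Set A} (hX : X.Finite) :
    (trajectory α F X).Finite :=
  finite_finsetSum (fun s => hX.image (α s)) F

theorem trajectory_nonempty (F : Finset S) {X : Set A} (hX : X.Nonempty) :
    (trajectory α F X).Nonempty :=
  nonempty_finsetSum (fun s => hX.image (α s)) F

theorem ncard_trajectory_pos (F : Finset S) {X : Set A} (hX : X.Finite) (hX' : X.Nonempty) :
    (0 : ℝ) < ((trajectory α F X).ncard : ℝ) := by
  exact_mod_cast (Set.ncard_pos (trajectory_finite F hX)).2 (trajectory_nonempty F hX')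

variable (α) in
/-- The trajectory of a subgroup, as a subgroup. -/
def trajectorySubgroup (F : Finset S) (X : AddSubgroup A) : AddSubgroup A where
  carrier := trajectory α F X
  zero_mem' := (Set.mem_finsetSum _ _ _).2
    ⟨fun _ => 0, fun {s} _ => ⟨0, X.zero_mem, map_zero (α s)⟩, by simp⟩
  add_mem' := by
    intro a b ha hb
    obtain ⟨g, hg, rfl⟩ := (Set.mem_finsetSum _ _ _).1 ha
    obtain ⟨g', hg', rfl⟩ := (Set.mem_finsetSum _ _ _).1 hb
    refine (Set.mem_finsetSum _ _ _).2 ⟨fun s => g s + g' s, fun {s} hs => ?_,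
      Finset.sum_add_distrib⟩
    obtain ⟨x, hx, hxs⟩ := hg hs
    obtain ⟨y, hy, hys⟩ := hg' hs
    exact ⟨x + y, X.add_mem hx hy, by rw [map_add, hxs, hys]⟩
  neg_mem' := by
    intro a ha
    obtain ⟨g, hg, rfl⟩ := (Set.mem_finsetSum _ _ _).1 ha
    refine (Set.mem_finsetSum _ _ _).2 ⟨fun s => -g s, fun {s} hs => ?_,
      Finset.sum_neg_distrib _⟩
    obtain ⟨x, hx, hxs⟩ := hg hs
    exact ⟨-x, X.neg_mem hx, by rw [map_neg, hxs]⟩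

theorem apply_mem_trajectory {F : Finset S} {t : S} (ht : t ∈ F) (X : AddSubgroup A) {x : A}
    (hx : x ∈ X) : α t x ∈ trajectory α F X := by
  classical
  refine (Set.mem_finsetSum _ _ _).2 ⟨fun s => if s = t then α t x else 0, fun {s} _ => ?_, ?_⟩
  · by_cases h : s = t
    · subst h
      simpa using ⟨x, hx, rfl⟩
    · simpa [h] using ⟨0, X.zero_mem, map_zero (α s)⟩
  · simp [ht]

end Trajectory

section Entropy

variable {S : Type u} [Monoid S] [IsCancelMul S] {A : Type v} [AddCommGroup A]
  {α : S →* AddMonoid.End A}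

theorem log_ncard_trajectory_div_card_le {X : Set A} (hX : X.Finite) (hX' : X.Nonempty)
    {E F : Finset S} (hE : E.Nonempty) (hF : F.Nonempty) :
    Real.log ((trajectory α F X).ncard : ℝ) / F.card ≤
      Real.log ((trajectory α E X).ncard : ℝ) / E.card +
        Real.log (X.ncard : ℝ) * folnerDefect E F := by
  classical
  refine log_ncard_sum_div_card_le (fun s => hX.image (α s)) (fun s => hX'.image (α s)) hE hF
    (Real.log_natCast_nonneg _) (Real.log_natCast_nonneg _) (fun t _ _ => ?_) (fun s _ => ?_)
  · have h := trajectory_image_mul (α := α) t E X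
    rw [trajectory] at h
    rw [h]
    refine Real.log_le_log ?_ (Nat.cast_le.2 (Set.ncard_image_le (trajectory_finite E hX)))
    rw [← trajectory_image_mul]
    exact ncard_trajectory_pos _ hX hX'
  · refine Real.log_le_log ?_ (Nat.cast_le.2 (Set.ncard_image_le hX))
    exact_mod_cast (Set.ncard_pos (hX.image _)).2 (hX'.image _)

/-- The entropy exists and equals the infimum of the averages `log |T_E(α, X)| / |E|`. -/
theorem isEntropyAt_iInf {X : Set A} (hX : X.Finite) (hX' : X.Nonempty) :
    IsEntropyAt α X (⨅ E : {E : Finset S // E.Nonempty},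
      Real.log ((trajectory α E X).ncard : ℝ) / (E : Finset S).card) :=
  fun _ _ _ _ _ hF => hF.tendsto_div_card (f := fun E => Real.log ((trajectory α E X).ncard : ℝ))
    (fun _ => Real.log_natCast_nonneg _)
    (fun _ _ hE hH => log_ncard_trajectory_div_card_le hX hX' hE hH)

theorem IsEntropyAt.unique (hS : IsRightAmenable S) {X : Set A} {h h' : ℝ}
    (hh : IsEntropyAt α X h) (hh' : IsEntropyAt α X h') : h = h' := by
  classical
  obtain ⟨F, hF⟩ := hS.exists_isRightFolnerNet
  exact tendsto_nhds_unique (hh _ F hF) (hh' _ F hF)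

variable (α) in
theorem entropyWellDefined (hS : IsRightAmenable S) : EntropyWellDefined α :=
  fun _ hX hX' => ⟨_, isEntropyAt_iInf hX hX', fun _ hh => hh.unique hS (isEntropyAt_iInf hX hX')⟩

theorem isEntropyAt_entropyAt {X : Set A} (hX : X.Finite) (hX' : X.Nonempty) :
    IsEntropyAt α X (entropyAt α X) := by
  have h : ∃ r, IsEntropyAt α X r := ⟨_, isEntropyAt_iInf hX hX'⟩
  rw [entropyAt, dif_pos h]
  exact h.choose_spec

theorem entropyAt_nonneg (hS : IsRightAmenable S) {X : Set A} (hX : X.Finite)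
    (hX' : X.Nonempty) : 0 ≤ entropyAt α X := by
  classical
  obtain ⟨F, hF⟩ := hS.exists_isRightFolnerNet
  exact ge_of_tendsto' (isEntropyAt_entropyAt hX hX' _ F hF) fun i =>
    div_nonneg (Real.log_natCast_nonneg _) (Nat.cast_nonneg _)

end Entropy

/-! ### The addition theorem -/

/-- Lagrange's theorem for the restriction of a homomorphism to a subgroup. -/
theorem ncard_eq_ncard_inter_ker_mul_ncard_image {A A' : Type*} [AddCommGroup A] [AddCommGroup A']
    (T : AddSubgroup A) (φ : A →+ A') :
    (T : Set A).ncard = ((T : Set A) ∩ φ.ker).ncard * (φ '' (T : Set A)).ncard := by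
  have h := AddSubgroup.card_mul_index (φ.comp T.subtype).ker
  rw [AddSubgroup.index_ker] at h
  have h1 : ((T : Set A) ∩ φ.ker) = T.subtype '' ((φ.comp T.subtype).ker : Set T) := by
    ext x
    constructor
    · rintro ⟨hx, hx'⟩
      exact ⟨⟨x, hx⟩, hx', rfl⟩
    · rintro ⟨y, hy, rfl⟩
      exact ⟨y.2, hy⟩
  have h2 : φ '' (T : Set A) = ((φ.comp T.subtype).range : Set A') := by
    ext x
    constructor
    · rintro ⟨y, hy, rfl⟩
      exact ⟨⟨y, hy⟩, rfl⟩
    · rintro ⟨y, rfl⟩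
      exact ⟨y, y.2, rfl⟩
  rw [h1, h2, Set.ncard_image_of_injective _ T.subtype_injective, ← Nat.card_coe_set_eq,
    ← Nat.card_coe_set_eq, ← Nat.card_coe_set_eq]
  exact h.symm

/-- If `φ` kills all elements of a finite subgroup `T` killed by `ψ`, then `φ(T)` is a quotient of
`ψ(T)`. -/
theorem ncard_image_le_ncard_image {A A' A'' : Type*} [AddCommGroup A] [AddCommGroup A']
    [AddCommGroup A''] {T : AddSubgroup A} (hT : (T : Set A).Finite) (φ : A →+ A') (ψ : A →+ A'')
    (h : ∀ x ∈ T, ψ x = 0 → φ x = 0) :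
    (φ '' (T : Set A)).ncard ≤ (ψ '' (T : Set A)).ncard := by
  have hsub : (T : Set A) ∩ ψ.ker ⊆ (T : Set A) ∩ φ.ker := fun x hx => ⟨hx.1, h x hx.1 hx.2⟩
  have h1 := Set.ncard_le_ncard hsub (hT.subset Set.inter_subset_left)
  have hpos : 0 < ((T : Set A) ∩ ψ.ker).ncard :=
    (Set.ncard_pos (hT.subset Set.inter_subset_left)).2 ⟨0, T.zero_mem, ψ.ker.zero_mem⟩
  have h2 := ncard_eq_ncard_inter_ker_mul_ncard_image T φ
  rw [ncard_eq_ncard_inter_ker_mul_ncard_image T ψ] at h2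
  refine Nat.le_of_mul_le_mul_left ?_ hpos
  rw [h2]
  exact Nat.mul_le_mul_right _ h1

section Addition

variable {S : Type u} [Monoid S] {A : Type v} [AddCommGroup A]
  {α : S →* AddMonoid.End A} {B : AddSubgroup A}

theorem subtype_restrictAction (hB : IsInvariant α B) (s : S) (b : B) :
    B.subtype (restrictAction α B hB s b) = α s (B.subtype b) := rfl

theorem mk_quotientAction (hB : IsInvariant α B) (s : S) (a : A) :
    QuotientAddGroup.mk' B (α s a) = quotientAction α B hB s (QuotientAddGroup.mk' B a) := rfl

theorem ofReal_entropyAt_le_ent {X : AddSubgroup A} (hX : (X : Set A).Finite) :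
    ENNReal.ofReal (entropyAt α (X : Set A)) ≤ ent α :=
  le_iSup₂_of_le (f := fun (X : AddSubgroup A) (_ : (X : Set A).Finite) =>
    ENNReal.ofReal (entropyAt α (X : Set A))) X hX le_rfl

variable [IsCancelMul S]

/-- Finite subgroups `Y` of `B` and `Z` of `A / B` are dominated by a single finite subgroup of
`A`, generated by `Y` and representatives of `Z`. -/
theorem entropyAt_add_entropyAt_le_ent (hS : IsRightAmenable S) (hA : IsAddTorsion A)
    (hB : IsInvariant α B) {Y : AddSubgroup B} (hY : (Y : Set B).Finite)
    {Z : AddSubgroup (A ⧸ B)} (hZ : (Z : Set (A ⧸ B)).Finite) :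
    ENNReal.ofReal (entropyAt (restrictAction α B hB) (Y : Set B)) +
      ENNReal.ofReal (entropyAt (quotientAction α B hB) (Z : Set (A ⧸ B))) ≤ ent α := by
  classical
  set gen : Set A := B.subtype '' (Y : Set B) ∪ Quotient.out '' (Z : Set (A ⧸ B)) with hgen
  have hgenfin : gen.Finite := (hY.image _).union (hZ.image _)
  set X := AddSubgroup.closure gen with hXdef
  have hXfin : (X : Set A).Finite := by
    have : AddGroup.FG X :=
      (AddGroup.fg_iff_addSubgroup_fg _).2 ⟨hgenfin.toFinset, by rw [hgenfin.coe_toFinset]⟩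
    have : Finite X := AddCommGroup.finite_of_fg_isAddTorsion X (hA.addSubgroup X)
    exact Set.toFinite _
  have hYX : B.subtype '' (Y : Set B) ⊆ X :=
    Set.subset_union_left.trans AddSubgroup.subset_closure
  have hZX : (Z : Set (A ⧸ B)) ⊆ QuotientAddGroup.mk' B '' (X : Set A) := fun z hz =>
    ⟨Quotient.out z, AddSubgroup.subset_closure (Or.inr ⟨z, hz, rfl⟩), Quotient.out_eq z⟩
  have hX0 : (X : Set A).Nonempty := ⟨0, X.zero_mem⟩
  have hY0 : (Y : Set B).Nonempty := ⟨0, Y.zero_mem⟩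
  have hZ0 : (Z : Set (A ⧸ B)).Nonempty := ⟨0, Z.zero_mem⟩
  have hlog : ∀ F : Finset S,
      Real.log ((trajectory (restrictAction α B hB) F Y).ncard : ℝ) +
        Real.log ((trajectory (quotientAction α B hB) F Z).ncard : ℝ) ≤
      Real.log ((trajectory α F X).ncard : ℝ) := by
    intro F
    have h1 : (trajectory (restrictAction α B hB) F Y).ncard ≤
        (trajectory α F X ∩ (QuotientAddGroup.mk' B).ker).ncard := by
      rw [← Set.ncard_image_of_injective _ B.subtype_injective]
      refine Set.ncard_le_ncard ?_ ((trajectory_finite F hXfin).subset Set.inter_subset_left)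
      rintro _ ⟨b, hb, rfl⟩
      refine ⟨trajectory_mono F hYX ?_, by simp⟩
      rw [← image_trajectory B.subtype (subtype_restrictAction hB)]
      exact ⟨b, hb, rfl⟩
    have h2 : (trajectory (quotientAction α B hB) F Z).ncard ≤
        (QuotientAddGroup.mk' B '' trajectory α F X).ncard := by
      refine Set.ncard_le_ncard ?_ ((trajectory_finite F hXfin).image _)
      rw [image_trajectory _ (mk_quotientAction hB)]
      exact trajectory_mono F hZX
    rw [← Real.log_mul (ncard_trajectory_pos F hY hY0).ne' (ncard_trajectory_pos F hZ hZ0).ne']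
    refine Real.log_le_log
      (mul_pos (ncard_trajectory_pos F hY hY0) (ncard_trajectory_pos F hZ hZ0)) ?_
    have h3 := ncard_eq_ncard_inter_ker_mul_ncard_image (trajectorySubgroup α F X)
      (QuotientAddGroup.mk' B)
    have h4 := (Nat.mul_le_mul h1 h2).trans h3.ge
    exact_mod_cast h4
  obtain ⟨F, hF⟩ := hS.exists_isRightFolnerNet
  have hle := le_of_tendsto_of_tendsto'
    ((isEntropyAt_entropyAt hY hY0 _ F hF).add (isEntropyAt_entropyAt hZ hZ0 _ F hF))
    (isEntropyAt_entropyAt (α := α) hXfin hX0 _ F hF) fun i => by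
      rw [← add_div]
      exact div_le_div_of_nonneg_right (hlog (F i)) (Nat.cast_nonneg _)
  rw [← ENNReal.ofReal_add (entropyAt_nonneg hS hY hY0) (entropyAt_nonneg hS hZ hZ0)]
  exact (ENNReal.ofReal_le_ofReal hle).trans (ofReal_entropyAt_le_ent hXfin)

/-- The finite form of the upper bound. Put `Y = T_E(α, X) ∩ B` and `W = T_F(α_B, Y)`. Modulo `W`,
every translate `T_{tE}(α, X)` with `t ∈ F` is a quotient of `T_E(α, X) / Y ≅ T_E(α_{A/B}, X)`, so
that the tiling of `F` by translates of `E` bounds the index of `W` in `T_F(α, X) + W`. -/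
theorem log_ncard_trajectory_div_card_le_add (hB : IsInvariant α B) {X : AddSubgroup A}
    (hX : (X : Set A).Finite) {E F : Finset S} (hE : E.Nonempty) (hF : F.Nonempty) :
    Real.log ((trajectory α F X).ncard : ℝ) / F.card ≤
      Real.log ((trajectory (restrictAction α B hB) F
        ((trajectorySubgroup α E X).comap B.subtype)).ncard : ℝ) / F.card +
      (Real.log ((trajectory (quotientAction α B hB) E
        (X.map (QuotientAddGroup.mk' B))).ncard : ℝ) / E.card +
      Real.log ((X : Set A).ncard : ℝ) * folnerDefect E F) := by
  classical
  set Y := (trajectorySubgroup α E X).comap B.subtype with hYdef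
  have hYfin : (Y : Set B).Finite :=
    Set.Finite.preimage (f := B.subtype) B.subtype_injective.injOn (trajectory_finite E hX)
  have hX0 : (X : Set A).Nonempty := ⟨0, X.zero_mem⟩
  have hY0 : (Y : Set B).Nonempty := ⟨0, Y.zero_mem⟩
  set W := (trajectorySubgroup (restrictAction α B hB) F Y).map B.subtype with hWdef
  have hWcoe : (W : Set A) = B.subtype '' trajectory (restrictAction α B hB) F Y := rfl
  have hWfin : (W : Set A).Finite := by
    rw [hWcoe]
    exact (trajectory_finite F hYfin).image _
  have hWcard : (W : Set A).ncard = (trajectory (restrictAction α B hB) F Y).ncard := by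
    rw [hWcoe, Set.ncard_image_of_injective _ B.subtype_injective]
  have hsum : ∀ H : Finset S, ∑ s ∈ H, QuotientAddGroup.mk' W '' (α s '' (X : Set A)) =
      QuotientAddGroup.mk' W '' trajectory α H X := fun H => by
    rw [trajectory, Set.image_finsetSum]
  have htile := log_ncard_sum_div_card_le
    (X := fun s => QuotientAddGroup.mk' W '' (α s '' (X : Set A)))
    (fun s => (hX.image _).image _) (fun s => (hX0.image _).image _) hE hF
    (a := Real.log ((trajectory (quotientAction α B hB) E
        (X.map (QuotientAddGroup.mk' B))).ncard : ℝ))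
    (b := Real.log ((X : Set A).ncard : ℝ))
    (Real.log_natCast_nonneg _) (Real.log_natCast_nonneg _) (fun t ht _ => by
      rw [hsum, trajectory_image_mul]
      refine Real.log_le_log ?_ (Nat.cast_le.2 ?_)
      · exact_mod_cast (Set.ncard_pos (((trajectory_finite E hX).image _).image _)).2
          (((trajectory_nonempty E hX0).image _).image _)
      · rw [AddSubgroup.coe_map, ← image_trajectory _ (mk_quotientAction hB), Set.image_image]
        refine ncard_image_le_ncard_image (T := trajectorySubgroup α E X) (trajectory_finite E hX)
          ((QuotientAddGroup.mk' W).comp (α t)) (QuotientAddGroup.mk' B) fun x hx hxB => ?_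
        have hxB' : x ∈ B := (QuotientAddGroup.eq_zero_iff x).1 hxB
        refine (QuotientAddGroup.eq_zero_iff (α t x)).2 ?_
        exact ⟨_, apply_mem_trajectory (α := restrictAction α B hB) ht Y (x := ⟨x, hxB'⟩) hx, rfl⟩)
    (fun s _ => by
      refine Real.log_le_log ?_ (Nat.cast_le.2 ?_)
      · exact_mod_cast (Set.ncard_pos ((hX.image _).image _)).2 ((hX0.image _).image _)
      · exact (Set.ncard_image_le (hX.image _)).trans (Set.ncard_image_le hX))
  rw [hsum] at htile
  refine le_trans ?_ (add_le_add_right htile _)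
  rw [← add_div]
  refine div_le_div_of_nonneg_right ?_ (Nat.cast_nonneg _)
  have hWpos := ncard_trajectory_pos (α := restrictAction α B hB) F hYfin hY0
  have hQpos : (0 : ℝ) < ((QuotientAddGroup.mk' W '' trajectory α F X).ncard : ℝ) := by
    exact_mod_cast (Set.ncard_pos ((trajectory_finite F hX).image _)).2
      ((trajectory_nonempty F hX0).image _)
  rw [← Real.log_mul hWpos.ne' hQpos.ne']
  refine Real.log_le_log (ncard_trajectory_pos F hX hX0) ?_
  have h1 := ncard_eq_ncard_inter_ker_mul_ncard_image (trajectorySubgroup α F X)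
    (QuotientAddGroup.mk' W)
  have h2 : ((trajectorySubgroup α F X : Set A) ∩ (QuotientAddGroup.mk' W).ker).ncard ≤
      (trajectory (restrictAction α B hB) F Y).ncard := by
    rw [← hWcard, QuotientAddGroup.ker_mk']
    exact Set.ncard_le_ncard Set.inter_subset_right hWfin
  have h3 := h1.le.trans (Nat.mul_le_mul_right _ h2)
  exact_mod_cast h3

theorem ofReal_entropyAt_le_ent_add_ent (hS : IsRightAmenable S) (hB : IsInvariant α B)
    {X : AddSubgroup A} (hX : (X : Set A).Finite) :
    ENNReal.ofReal (entropyAt α (X : Set A)) ≤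
      ent (restrictAction α B hB) + ent (quotientAction α B hB) := by
  classical
  rcases eq_or_ne (ent (restrictAction α B hB)) ⊤ with htop | htop
  · simp [htop]
  have hX0 : (X : Set A).Nonempty := ⟨0, X.zero_mem⟩
  set Z := X.map (QuotientAddGroup.mk' B) with hZdef
  have hZ : (Z : Set (A ⧸ B)).Finite := hX.image _
  have hZ0 : (Z : Set (A ⧸ B)).Nonempty := ⟨0, Z.zero_mem⟩
  obtain ⟨F, hF⟩ := hS.exists_isRightFolnerNet
  have hbound : ∀ E : Finset S, E.Nonempty → entropyAt α (X : Set A) ≤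
      (ent (restrictAction α B hB)).toReal +
        Real.log ((trajectory (quotientAction α B hB) E Z).ncard : ℝ) / E.card := by
    intro E hE
    set Y := (trajectorySubgroup α E X).comap B.subtype with hYdef
    have hY : (Y : Set B).Finite :=
      Set.Finite.preimage (f := B.subtype) B.subtype_injective.injOn (trajectory_finite E hX)
    have hY0 : (Y : Set B).Nonempty := ⟨0, Y.zero_mem⟩
    have h1 := le_of_tendsto_of_tendsto' (isEntropyAt_entropyAt (α := α) hX hX0 _ F hF)
      ((isEntropyAt_entropyAt (α := restrictAction α B hB) hY hY0 _ F hF).add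
        (((hF.tendsto_folnerDefect E).const_mul (Real.log ((X : Set A).ncard : ℝ))).const_add
          (Real.log ((trajectory (quotientAction α B hB) E Z).ncard : ℝ) / E.card)))
      fun i => log_ncard_trajectory_div_card_le_add hB hX hE (hF.1 i)
    rw [mul_zero, add_zero] at h1
    refine h1.trans (add_le_add_left ?_ _)
    exact (ENNReal.ofReal_le_iff_le_toReal htop).1 (ofReal_entropyAt_le_ent hY)
  have hle : entropyAt α (X : Set A) ≤ (ent (restrictAction α B hB)).toReal +
      entropyAt (quotientAction α B hB) (Z : Set (A ⧸ B)) :=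
    ge_of_tendsto' ((isEntropyAt_entropyAt hZ hZ0 _ F hF).const_add _)
      fun i => hbound (F i) (hF.1 i)
  refine (ENNReal.ofReal_le_ofReal hle).trans (ENNReal.ofReal_add_le.trans ?_)
  rw [ENNReal.ofReal_toReal htop]
  exact add_le_add_right (ofReal_entropyAt_le_ent hZ) _

end Addition

end AmenableEntropy

theorem theorem1p1 {S : Type u} [Monoid S] [IsCancelMul S]
    (hS : AmenableEntropy.IsRightAmenable S)
    {A : Type v} [AddCommGroup A] (hA : IsAddTorsion A)
    (α : S →* AddMonoid.End A) (B : AddSubgroup A) (hB : AmenableEntropy.IsInvariant α B) :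
    (AmenableEntropy.EntropyWellDefined α ∧
      AmenableEntropy.EntropyWellDefined (AmenableEntropy.restrictAction α B hB) ∧
      AmenableEntropy.EntropyWellDefined (AmenableEntropy.quotientAction α B hB)) ∧
    AmenableEntropy.ent α =
      AmenableEntropy.ent (AmenableEntropy.restrictAction α B hB) +
        AmenableEntropy.ent (AmenableEntropy.quotientAction α B hB) := by
  refine ⟨⟨AmenableEntropy.entropyWellDefined _ hS, AmenableEntropy.entropyWellDefined _ hS,
    AmenableEntropy.entropyWellDefined _ hS⟩, le_antisymm ?_ ?_⟩
  · exact iSup₂_le fun X hX => AmenableEntropy.ofReal_entropyAt_le_ent_add_ent hS hB hX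
  · exact ENNReal.biSup_add_biSup_le' ⟨⊥, by simp⟩ ⟨⊥, by simp⟩ fun Y hY Z hZ =>
      AmenableEntropy.entropyAt_add_entropyAt_le_ent hS hA hB hY hZ
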